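/- **Theorem 1.2.** Let $K\subset\mathbb{E}^3$ be a nonempty compact convex set with volume $V$ and mean curvature integral $M$. Here, for a possibly non-smooth $K$, $M$ is the coefficient of $t^2$ in the Steiner polynomial of $K$, that is, with $B$ the closed unit ball, $$M=\lim_{t\to\infty}\frac{\operatorname{vol}(K+tB)-\frac{4\pi}{3}t^3}{t^2}$$ (the limit exists; $M$ is the integral of the mean curvature over $\partial K$ when $K$ has interior points and $\partial K$ is of class $C^2$). For $P\notin K$ let $\Omega(P)\subset S^2$ be the solid angle of $K$ seen from $P$, i.e. the set of unit vectors $u$ such that the ray $\{P+tu: t\ge 0\}$ meets $K$. For $\Omega\subset S^2$ let $\tilde\Omega$ be the set of unit vectors $v$ such that the plane $v^{\perp}$ through the origin meets $\Omega$, and put $$\beta(\Omega)=\frac18\int_{v_1,v_2,v_3\in\tilde\Omega}|\det(v_1,v_2,v_3)|\,dv_1\,dv_2\,dv_3,$$ where $dv$ is the Lebesgue (surface area) measure on $S^2$. Then $P\mapsto\beta(\Omega(P))$ is integrable over $\mathbb{E}^3\setminus K$ and $$M^3-\pi^4V=\int_{P\notin K}\beta(\Omega(P))\,dP .$$ -/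

import Mathlib

open scoped Pointwise

/-- Euclidean three-space. -/
abbrev E3 : Type := EuclideanSpace ℝ (Fin 3)

/-- The unit sphere of Euclidean three-space. -/
abbrev S2 : Type := Metric.sphere (0 : E3) 1

/-- Lebesgue (surface area) measure on the unit sphere, of total mass `4π`. -/
noncomputable def sphereMeasure : MeasureTheory.Measure S2 :=
  (MeasureTheory.volume : MeasureTheory.Measure E3).toSphere

/-- The solid angle of `K` seen from `P`: the unit directions `u` such that the ray
`P + t u`, `t ≥ 0`, meets `K`. -/
def solidAngle (K : Set E3) (P : E3) : Set S2 :=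
  {u | ∃ t : ℝ, 0 ≤ t ∧ P + t • (u : E3) ∈ K}

/-- For `Ω` in the sphere, the set of unit vectors `v` such that the plane through the origin
orthogonal to `v` meets `Ω`. -/
def greatCirclesMeeting (Ω : Set S2) : Set S2 :=
  {v | ∃ u ∈ Ω, inner ℝ (v : E3) (u : E3) = 0}

/-- The set function `β(Ω) = (1/8) ∫ |det(v₁, v₂, v₃)| dv₁ dv₂ dv₃`, the integral being over all
triples of unit vectors whose orthogonal planes meet `Ω`. -/
noncomputable def solidAngleBeta (Ω : Set S2) : ℝ :=
  (1 / 8) * ∫ v in Set.univ.pi (fun _ : Fin 3 => greatCirclesMeeting Ω),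
    |Matrix.det (Matrix.of fun i j : Fin 3 => (v i : E3) j)|
      ∂(MeasureTheory.Measure.pi fun _ : Fin 3 => sphereMeasure)

/-- `(V(K + tB) - (4π/3) t³) / t²`, where `B` is the closed unit ball and `V` is volume. -/
noncomputable def steinerQuotient (K : Set E3) (t : ℝ) : ℝ :=
  (MeasureTheory.volume.real (K + Metric.closedBall (0 : E3) t)
    - 4 / 3 * Real.pi * t ^ 3) / t ^ 2

/-- The mean curvature integral `M` of a (not necessarily smooth) compact convex set `K`: the
coefficient of `t²` in the Steiner polynomial `V(K + tB) = V + F t + M t² + (4π/3) t³`, obtained as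
the limit of `(V(K + tB) - (4π/3) t³) / t²` for `t → ∞`. In terms of mixed volumes it is
`3 V(K, B, B)`. -/
noncomputable def meanCurvatureIntegral (K : Set E3) : ℝ :=
  Filter.limUnder Filter.atTop (steinerQuotient K)

/-- Wherever Steiner's formula holds, `meanCurvatureIntegral K` is its coefficient of `t²`. -/
theorem meanCurvatureIntegral_eq_of_steiner (K : Set E3) (V F M : ℝ)
    (h : ∀ t : ℝ, 0 ≤ t → MeasureTheory.volume.real (K + Metric.closedBall (0 : E3) t)
      = V + F * t + M * t ^ 2 + 4 / 3 * Real.pi * t ^ 3) :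
    meanCurvatureIntegral K = M := by
  refine Filter.Tendsto.limUnder_eq ?_
  have h1 : Filter.Tendsto (fun t : ℝ => t⁻¹) Filter.atTop (nhds 0) := tendsto_inv_atTop_zero
  have h2 : Filter.Tendsto (fun t : ℝ => V * (t⁻¹ * t⁻¹) + F * t⁻¹ + M) Filter.atTop
      (nhds (V * (0 * 0) + F * 0 + M)) :=
    (((h1.mul h1).const_mul V).add (h1.const_mul F)).add_const M
  have h3 : V * (0 * 0) + F * 0 + M = M := by ring
  rw [h3] at h2
  refine h2.congr' ?_
  filter_upwards [Filter.eventually_gt_atTop (0 : ℝ)] with t ht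
  rw [steinerQuotient, h t ht.le]
  field_simp
  ring

open MeasureTheory Set
open scoped Pointwise
open Filter Topology

/-! Integrate |det(v₁, v₂, v₃)| over all points P and unit triples v such that the three planes
through P orthogonal to the vᵢ meet K, in both orders. For fixed v with nonzero determinant, P ↦
(⟨vᵢ, P⟩)ᵢ carries the admissible P onto a box whose sides are the widths of K in the directions vᵢ,
and its Jacobian cancels the weight. What remains is the product of the widths. Its integral over v
is (2∫h)³ = 8M³, where h is the support function (`lintegral_planeTripleIntegral`). For fixed P ∈ K
every triple is admissible and gives ∫|det| = 8π⁴ (`integral_abs_sphereDet`); for P ∉ K the inner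
integral is 8β(Ω(P)). Dividing by 8 gives the formula. The identity M = ∫h holds because the radial
function of K + tB is t + h(u) + O(1/t) (`tendsto_steinerQuotient`). -/

instance isFiniteMeasure_sphereMeasure : IsFiniteMeasure sphereMeasure :=
  inferInstanceAs (IsFiniteMeasure (volume : Measure E3).toSphere)

/-! ### Spherical integrals by Gaussian weights -/

theorem sphereMeasure_real_univ : sphereMeasure.real univ = 4 * Real.pi := by
  rw [sphereMeasure, Measure.toSphere_real_apply_univ, Measure.real,
    EuclideanSpace.volume_ball_fin_three]
  have : (0 : ℝ) ≤ Real.pi * 4 / 3 := by positivity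
  simp [ENNReal.toReal_ofReal this]
  ring

theorem measurePreserving_polar : MeasurePreserving (homeomorphUnitSphereProd E3)
    ((volume : Measure E3).comap (↑)) (sphereMeasure.prod (Measure.volumeIoiPow 2)) := by
  have h := (volume : Measure E3).measurePreserving_homeomorphUnitSphereProd
  simpa [sphereMeasure] using h

/-- Integration in polar coordinates of a positively homogeneous function of degree one against
the Gaussian weight. -/
theorem integral_mul_exp_neg_norm_sq {f : E3 → ℝ}
    (hf : ∀ (r : ℝ) (x : E3), 0 < r → f (r • x) = r * f x) :
    ∫ x : E3, f x * Real.exp (-‖x‖ ^ 2) = (∫ u : S2, f u ∂sphereMeasure) * (1 / 2) := by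
  have hradial : ∫ r : Ioi (0 : ℝ), (r : ℝ) * Real.exp (-(r : ℝ) ^ 2) ∂(Measure.volumeIoiPow 2)
      = 1 / 2 := by
    rw [Measure.volumeIoiPow]
    simp only [ENNReal.ofReal]
    rw [integral_withDensity_eq_integral_smul (by fun_prop),
      integral_subtype_comap measurableSet_Ioi
        fun a : ℝ ↦ Real.toNNReal (a ^ 2) • (a * Real.exp (-a ^ 2))]
    -- The polar density r² and the homogeneity factor r combine to r³, whose Gaussian integral is
    -- Γ(2)/2.
    have h := integral_rpow_mul_exp_neg_rpow (p := 2) (q := 3) (by norm_num) (by norm_num)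
    have h4 : Real.Gamma ((3 + 1) / 2) = 1 := by
      rw [show ((3 : ℝ) + 1) / 2 = 2 by norm_num, Real.Gamma_two]
    rw [h4, mul_one] at h
    rw [← h]
    refine setIntegral_congr_fun measurableSet_Ioi fun x hx ↦ ?_
    have hx' : (0 : ℝ) ≤ x ^ 2 := by positivity
    simp only [NNReal.smul_def, Real.coe_toNNReal _ hx', smul_eq_mul]
    norm_cast
    ring
  calc ∫ x : E3, f x * Real.exp (-‖x‖ ^ 2)
      = ∫ x : ({(0 : E3)}ᶜ : Set E3), f x * Real.exp (-‖(x : E3)‖ ^ 2)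
          ∂((volume : Measure E3).comap (↑)) := by
        rw [integral_subtype_comap (measurableSet_singleton _).compl
          fun x : E3 ↦ f x * Real.exp (-‖x‖ ^ 2), restrict_compl_singleton]
    _ = ∫ p : S2 × Ioi (0 : ℝ), f (p.1 : E3) * ((p.2 : ℝ) * Real.exp (-(p.2 : ℝ) ^ 2))
          ∂(sphereMeasure.prod (Measure.volumeIoiPow 2)) := by
        rw [← measurePreserving_polar.integral_comp (Homeomorph.measurableEmbedding _)]
        refine integral_congr_ae (.of_forall fun x ↦ ?_)
        have hx : 0 < ‖(x : E3)‖ := norm_pos_iff.2 x.2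
        simp only [homeomorphUnitSphereProd_apply_snd_coe, homeomorphUnitSphereProd_apply_fst_coe]
        rw [hf _ _ (inv_pos.2 hx)]
        field_simp
    _ = _ := by rw [integral_prod_mul (fun u : S2 ↦ f u)
          (fun r : Ioi (0 : ℝ) ↦ (r : ℝ) * Real.exp (-(r : ℝ) ^ 2)), hradial]

/-- The Gaussian weight is even, so the symmetry is inherited from Lebesgue measure on space. -/
theorem integral_sphere_neg {f : E3 → ℝ}
    (hf : ∀ (r : ℝ) (x : E3), 0 < r → f (r • x) = r * f x) :
    ∫ u : S2, f (-(u : E3)) ∂sphereMeasure = ∫ u : S2, f u ∂sphereMeasure := by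
  have h1 := integral_mul_exp_neg_norm_sq hf
  have h2 := integral_mul_exp_neg_norm_sq (f := fun x ↦ f (-x))
    (fun r x hr ↦ by rw [← smul_neg, hf r _ hr])
  have h3 := integral_neg_eq_self (fun x : E3 ↦ f x * Real.exp (-‖x‖ ^ 2)) volume
  simp only [norm_neg] at h3
  linarith

/-- Integrals over space that split into a function of the first coordinate and a radial function
of the other two. -/
theorem integral_coord_mul_radial (f g : ℝ → ℝ) :
    ∫ x : E3, f (x 0) * g (√(x 1 ^ 2 + x 2 ^ 2)) = (∫ t, f t) * ∫ z : ℂ, g ‖z‖ := by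
  have h1 := (EuclideanSpace.volume_preserving_symm_measurableEquiv_toLp (Fin 3)).integral_comp'
    (g := fun x : Fin 3 → ℝ ↦ f (x 0) * g (√(x 1 ^ 2 + x 2 ^ 2)))
  have h2 := (volume_preserving_piFinSuccAbove (fun _ : Fin 3 ↦ ℝ) 0).integral_comp'
    (g := fun p : ℝ × (Fin 2 → ℝ) ↦ f p.1 * g (√(p.2 0 ^ 2 + p.2 1 ^ 2)))
  have h3 := Complex.volume_preserving_equiv_pi.integral_comp'
    (g := fun p : Fin 2 → ℝ ↦ g (√(p 0 ^ 2 + p 1 ^ 2)))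
  refine h1.trans (Eq.trans ?_ (h2.trans ?_))
  · rfl
  · rw [show (volume : Measure (ℝ × (Fin 2 → ℝ))) = volume.prod volume from rfl,
      integral_prod_mul f (fun p : Fin 2 → ℝ ↦ g (√(p 0 ^ 2 + p 1 ^ 2))), ← h3]
    congr 2
    ext z
    rw [Complex.norm_eq_sqrt_sq_add_sq]
    rfl

theorem norm_sq_eq_coord (x : E3) : ‖x‖ ^ 2 = x 0 ^ 2 + (x 1 ^ 2 + x 2 ^ 2) := by
  rw [EuclideanSpace.real_norm_sq_eq, Fin.sum_univ_three]
  ring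

theorem integral_sphere_abs_coord : ∫ u : S2, |(u : E3) 0| ∂sphereMeasure = 2 * Real.pi := by
  have h1 := integral_mul_exp_neg_norm_sq (f := fun x : E3 ↦ |x 0|)
    (fun r x hr ↦ by simp [abs_mul, abs_of_pos hr])
  have h2 := integral_coord_mul_radial (fun t ↦ |t| * Real.exp (-t ^ 2)) (fun r ↦ Real.exp (-r ^ 2))
  have h3 : ∫ t : ℝ, |t| * Real.exp (-t ^ 2) = 1 := by
    have h := integral_comp_abs (f := fun t ↦ t * Real.exp (-t ^ 2))
    simp only [sq_abs] at h
    rw [h]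
    have h' := integral_rpow_mul_exp_neg_rpow (p := 2) (q := 1) (by norm_num) (by norm_num)
    norm_num at h'
    rw [h']
    norm_num
  have h4 : ∫ z : ℂ, Real.exp (-‖z‖ ^ 2) = Real.pi := by
    have h' := Complex.integral_rpow_mul_exp_neg_rpow (p := 2) (q := 0) (by norm_num) (by norm_num)
    norm_num at h'
    exact h'
  rw [h3, h4] at h2
  have h5 : ∫ x : E3, |x 0| * Real.exp (-‖x‖ ^ 2) = 1 * Real.pi := by
    rw [← h2]
    congr 1
    ext x
    rw [norm_sq_eq_coord, Real.sq_sqrt (by positivity), neg_add, Real.exp_add]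
    ring
  linarith

/-- The Gaussian splits into a line factor √π and a planar factor π√π/2; doubling their product
gives π². -/
theorem integral_sphere_norm_transverse :
    ∫ u : S2, √((u : E3) 1 ^ 2 + (u : E3) 2 ^ 2) ∂sphereMeasure = Real.pi ^ 2 := by
  have h1 := integral_mul_exp_neg_norm_sq (f := fun x : E3 ↦ √(x 1 ^ 2 + x 2 ^ 2))
    (fun r x hr ↦ by
      simp only [PiLp.smul_apply, smul_eq_mul, mul_pow]
      rw [← mul_add, Real.sqrt_mul (by positivity), Real.sqrt_sq hr.le])
  have h2 := integral_coord_mul_radial (fun t ↦ Real.exp (-t ^ 2))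
    (fun r ↦ r * Real.exp (-r ^ 2))
  have h3 : ∫ t : ℝ, Real.exp (-t ^ 2) = √Real.pi := by
    simpa using integral_gaussian 1
  have h4 : ∫ z : ℂ, ‖z‖ * Real.exp (-‖z‖ ^ 2) = Real.pi * (√Real.pi / 2) := by
    have h' := Complex.integral_rpow_mul_exp_neg_rpow (p := 2) (q := 1) (by norm_num) (by norm_num)
    have hG : Real.Gamma ((1 + 2) / 2) = √Real.pi / 2 := by
      rw [show ((1 : ℝ) + 2) / 2 = 1 / 2 + 1 by norm_num, Real.Gamma_add_one (by norm_num),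
        Real.Gamma_one_half_eq]
      ring
    rw [hG] at h'
    norm_num at h'
    rw [h']
  rw [h3, h4] at h2
  have h5 : ∫ x : E3, √(x 1 ^ 2 + x 2 ^ 2) * Real.exp (-‖x‖ ^ 2)
      = √Real.pi * (Real.pi * (√Real.pi / 2)) := by
    rw [← h2]
    congr 1
    ext x
    rw [norm_sq_eq_coord, Real.sq_sqrt (by positivity), neg_add, Real.exp_add]
    ring
  have h6 : √Real.pi * √Real.pi = Real.pi := Real.mul_self_sqrt Real.pi_pos.le
  nlinarith

/-- Rotating a to the first axis reduces integrals depending on ⟨a, u⟩ to the coordinate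
computations above. -/
theorem exists_linearIsometryEquiv_coord (a : E3) (ha : ‖a‖ = 1) :
    ∃ L : E3 ≃ₗᵢ[ℝ] E3, ∀ x, (L x) 0 = inner ℝ a x := by
  obtain ⟨b, hb⟩ := Orthonormal.exists_orthonormalBasis_extension_of_card_eq (𝕜 := ℝ) (E := E3)
    (ι := Fin 3) (by simp) (v := fun _ ↦ a) (s := {0})
    (by
      rw [orthonormal_iff_ite]
      rintro ⟨i, rfl⟩ ⟨j, rfl⟩
      simp [ha])
  exact ⟨b.repr, fun x ↦ by rw [OrthonormalBasis.repr_apply_apply, hb 0 (by simp)]⟩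

theorem integral_sphere_comp_linearIsometryEquiv {f : E3 → ℝ}
    (hf : ∀ (r : ℝ) (x : E3), 0 < r → f (r • x) = r * f x) (L : E3 ≃ₗᵢ[ℝ] E3) :
    ∫ u : S2, f (L u) ∂sphereMeasure = ∫ u : S2, f u ∂sphereMeasure := by
  have h1 := integral_mul_exp_neg_norm_sq hf
  have h2 := integral_mul_exp_neg_norm_sq (f := fun x ↦ f (L x))
    (fun r x hr ↦ by rw [map_smul, hf r _ hr])
  have h3 := L.measurePreserving.integral_comp L.toMeasurableEquiv.measurableEmbedding
    (fun x : E3 ↦ f x * Real.exp (-‖x‖ ^ 2))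
  simp only [L.norm_map] at h3
  linarith

theorem integral_sphere_abs_inner (a : E3) :
    ∫ u : S2, |inner ℝ a (u : E3)| ∂sphereMeasure = 2 * Real.pi * ‖a‖ := by
  rcases eq_or_ne a 0 with rfl | ha
  · simp
  have ha' : 0 < ‖a‖ := norm_pos_iff.2 ha
  obtain ⟨L, hL⟩ := exists_linearIsometryEquiv_coord (‖a‖⁻¹ • a) (norm_smul_inv_norm ha)
  have h := integral_sphere_comp_linearIsometryEquiv (f := fun x : E3 ↦ |x 0|)
    (fun r x hr ↦ by simp [abs_mul, abs_of_pos hr]) L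
  simp only [hL, integral_sphere_abs_coord, inner_smul_left, abs_mul, integral_const_mul] at h
  simp at h
  field_simp at h
  linarith

theorem integral_sphere_sqrt_one_sub_inner_sq (a : S2) :
    ∫ u : S2, √(1 - inner ℝ (a : E3) (u : E3) ^ 2) ∂sphereMeasure = Real.pi ^ 2 := by
  obtain ⟨L, hL⟩ := exists_linearIsometryEquiv_coord a (by simp)
  have h := integral_sphere_comp_linearIsometryEquiv (f := fun x : E3 ↦ √(x 1 ^ 2 + x 2 ^ 2))
    (fun r x hr ↦ by
      simp only [PiLp.smul_apply, smul_eq_mul, mul_pow]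
      rw [← mul_add, Real.sqrt_mul (by positivity), Real.sqrt_sq hr.le]) L
  rw [integral_sphere_norm_transverse] at h
  rw [← h]
  congr 1
  ext u
  have h1 := norm_sq_eq_coord (L u)
  rw [L.norm_map, hL] at h1
  simp at h1
  congr 1
  linarith

/-! ### Volumes from radial functions -/

theorem volume_eq_polar (S : Set E3) :
    volume S = sphereMeasure.prod (Measure.volumeIoiPow 2)
      {p : S2 × Ioi (0 : ℝ) | (p.2 : ℝ) • (p.1 : E3) ∈ S} := by
  have h := measurePreserving_polar.measure_preimage_equiv
    (f := (homeomorphUnitSphereProd E3).toMeasurableEquiv)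
    {p : S2 × Ioi (0 : ℝ) | (p.2 : ℝ) • (p.1 : E3) ∈ S}
  rw [← h]
  have h1 : (homeomorphUnitSphereProd E3).toMeasurableEquiv ⁻¹'
      {p : S2 × Ioi (0 : ℝ) | (p.2 : ℝ) • (p.1 : E3) ∈ S} = Subtype.val ⁻¹' S := by
    ext x
    simp only [mem_preimage, mem_ofPred_eq]
    rw [← homeomorphUnitSphereProd_symm_apply_coe]
    simp
  rw [h1, comap_subtype_coe_apply (measurableSet_singleton _).compl, Subtype.image_preimage_coe,
    inter_comm, ← sdiff_eq, measure_sdiff_null (measure_singleton _)]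

theorem prod_measure_lt_radius {f : S2 → ℝ} (hf : Continuous f) (hpos : ∀ u, 0 < f u) :
    sphereMeasure.prod (Measure.volumeIoiPow 2) {p : S2 × Ioi (0 : ℝ) | (p.2 : ℝ) < f p.1}
      = ENNReal.ofReal (∫ u, f u ^ 3 / 3 ∂sphereMeasure) := by
  have hm : MeasurableSet {p : S2 × Ioi (0 : ℝ) | (p.2 : ℝ) < f p.1} :=
    measurableSet_lt (by fun_prop) (by fun_prop)
  have hint : Integrable (fun u ↦ f u ^ 3 / 3) sphereMeasure :=
    Continuous.integrable_of_hasCompactSupport (by fun_prop) (HasCompactSupport.of_compactSpace _)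
  rw [Measure.prod_apply hm, ofReal_integral_eq_lintegral_ofReal hint
    (.of_forall fun u ↦ by have := hpos u; positivity)]
  refine lintegral_congr fun u ↦ ?_
  have h := Measure.volumeIoiPow_apply_Iio 2 ⟨f u, hpos u⟩
  norm_num at h
  rw [← h]
  rfl

theorem volume_real_le_of_radius {S : Set E3} {f : S2 → ℝ} (hf : Continuous f)
    (hpos : ∀ u, 0 < f u) (h : ∀ (u : S2) (r : ℝ), 0 < r → r • (u : E3) ∈ S → r < f u) :
    volume.real S ≤ ∫ u, f u ^ 3 / 3 ∂sphereMeasure := by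
  have h0 : 0 ≤ ∫ u, f u ^ 3 / 3 ∂sphereMeasure :=
    integral_nonneg fun u ↦ by have := hpos u; positivity
  refine ENNReal.toReal_le_of_le_ofReal h0 ?_
  rw [← prod_measure_lt_radius hf hpos, volume_eq_polar]
  exact measure_mono fun p hp ↦ h p.1 p.2 p.2.2 hp

theorem le_volume_real_of_radius {S : Set E3} (hS : volume S ≠ ⊤) {f : S2 → ℝ} (hf : Continuous f)
    (hpos : ∀ u, 0 < f u) (h : ∀ (u : S2) (r : ℝ), 0 < r → r < f u → r • (u : E3) ∈ S) :
    ∫ u, f u ^ 3 / 3 ∂sphereMeasure ≤ volume.real S := by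
  refine (ENNReal.ofReal_le_iff_le_toReal hS).1 ?_
  rw [← prod_measure_lt_radius hf hpos, volume_eq_polar]
  exact measure_mono fun p hp ↦ h p.1 p.2 p.2.2 hp

/-- The support function `x ↦ max_{y ∈ K} ⟪x, y⟫` of a set. -/
noncomputable def supportFn (K : Set E3) (x : E3) : ℝ := sSup ((fun y ↦ inner ℝ x y) '' K)

/-! ### Support function and mean curvature integral -/

section SupportFunction
variable {K : Set E3}

theorem continuous_supportFn (hK : IsCompact K) : Continuous (supportFn K) :=
  hK.continuous_sSup (f := fun x y : E3 ↦ inner ℝ x y) (by fun_prop)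

theorem inner_le_supportFn (hK : IsCompact K) (x : E3) {y : E3} (hy : y ∈ K) :
    inner ℝ x y ≤ supportFn K x :=
  le_csSup (hK.image (f := fun y : E3 ↦ inner ℝ x y) (by fun_prop)).bddAbove (mem_image_of_mem _ hy)

theorem exists_inner_eq_supportFn (hK : IsCompact K) (hne : K.Nonempty) (x : E3) :
    ∃ y ∈ K, inner ℝ x y = supportFn K x :=
  (hK.image (f := fun y : E3 ↦ inner ℝ x y) (by fun_prop)).sSup_mem (hne.image _)

theorem supportFn_smul (hK : IsCompact K) (hne : K.Nonempty) (r : ℝ) (x : E3) (hr : 0 < r) :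
    supportFn K (r • x) = r * supportFn K x := by
  apply le_antisymm
  · obtain ⟨y, hy, h⟩ := exists_inner_eq_supportFn hK hne (r • x)
    rw [← h, real_inner_smul_left]
    exact mul_le_mul_of_nonneg_left (inner_le_supportFn hK x hy) hr.le
  · obtain ⟨y, hy, h⟩ := exists_inner_eq_supportFn hK hne x
    rw [← h, ← real_inner_smul_left]
    exact inner_le_supportFn hK _ hy

theorem abs_supportFn_le (hK : IsCompact K) (hne : K.Nonempty) {R : ℝ} (hR : ∀ y ∈ K, ‖y‖ ≤ R)
    (u : S2) : |supportFn K u| ≤ R := by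
  obtain ⟨y, hy, h⟩ := exists_inner_eq_supportFn hK hne u
  rw [← h]
  refine (abs_real_inner_le_norm _ _).trans ?_
  simpa using hR y hy

/-- Compactness attains both endpoints and connectedness fills the gap. This turns "the plane meets
K" into two inequalities. -/
theorem image_inner_eq_Icc (hK : IsCompact K) (hconv : Convex ℝ K) (hne : K.Nonempty) (x : E3) :
    (fun y ↦ inner ℝ x y) '' K = Icc (-supportFn K (-x)) (supportFn K x) := by
  apply Subset.antisymm
  · rintro _ ⟨y, hy, rfl⟩
    refine ⟨?_, inner_le_supportFn hK x hy⟩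
    have := inner_le_supportFn hK (-x) hy
    rw [inner_neg_left] at this
    linarith
  · obtain ⟨y, hy, h⟩ := exists_inner_eq_supportFn hK hne x
    obtain ⟨z, hz, h'⟩ := exists_inner_eq_supportFn hK hne (-x)
    rw [inner_neg_left] at h'
    have hc : IsPreconnected ((fun y : E3 ↦ inner ℝ x y) '' K) :=
      hconv.isPreconnected.image _ (by fun_prop)
    exact hc.Icc_subset ⟨z, hz, by linarith⟩ ⟨y, hy, h⟩

theorem le_radius_of_mem_add_closedBall (hK : IsCompact K) {t : ℝ} (u : S2) {r : ℝ}
    (h : r • (u : E3) ∈ K + Metric.closedBall (0 : E3) t) : r ≤ t + supportFn K u := by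
  obtain ⟨y, hy, b, hb, hyb⟩ := h
  rw [mem_closedBall_zero_iff] at hb
  have h1 := inner_le_supportFn hK u hy
  have h2 : inner ℝ (u : E3) b ≤ t := by
    refine (real_inner_le_norm _ _).trans ?_
    simpa using hb
  have h3 : inner ℝ (u : E3) (y + b) = r := by
    change y + b = r • (u : E3) at hyb
    rw [hyb, real_inner_smul_right, real_inner_self_eq_norm_sq]
    simp
  rw [inner_add_right] at h3
  linarith

/-- The ball of radius t about a contact point y, where ⟨u, y⟩ = h(u), already contains s • u for s
= t + h(u) - R²/t. Smaller r follow by convexity, since R ≤ t puts 0 in K + tB. -/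
theorem mem_add_closedBall_of_lt_radius (hK : IsCompact K) (hconv : Convex ℝ K) (hne : K.Nonempty)
    {R : ℝ} (hR : ∀ y ∈ K, ‖y‖ ≤ R) {t : ℝ} (ht : 0 < t) (hRt : R ≤ t) (u : S2) {r : ℝ}
    (hr : 0 < r) (h : r < t + supportFn K u + -R ^ 2 / t) :
    r • (u : E3) ∈ K + Metric.closedBall (0 : E3) t := by
  obtain ⟨y, hy, hyu⟩ := exists_inner_eq_supportFn hK hne u
  set s : ℝ := t + supportFn K u + -R ^ 2 / t with hs
  have hy' : ‖y‖ ^ 2 ≤ R ^ 2 := pow_le_pow_left₀ (norm_nonneg _) (hR y hy) 2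
  have hR0 : 0 ≤ R := (norm_nonneg y).trans (hR y hy)
  have hc : Convex ℝ (K + Metric.closedBall (0 : E3) t) := hconv.add (convex_closedBall _ _)
  have h0 : (0 : E3) ∈ K + Metric.closedBall (0 : E3) t :=
    ⟨y, hy, -y, by simpa using (hR y hy).trans hRt, by simp⟩
  have hsmem : s • (u : E3) ∈ K + Metric.closedBall (0 : E3) t := by
    refine ⟨y, hy, s • (u : E3) - y, ?_, by simp⟩
    rw [mem_closedBall_zero_iff]
    refine abs_le_of_sq_le_sq' ?_ ht.le |>.2
    -- The square equals (t - R²/t)² + ‖y‖² - h(u)², at most t² - R² + R⁴/t², hence at most t²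
    -- because R ≤ t.
    rw [norm_sub_sq_real, real_inner_smul_left, hyu, norm_smul]
    have hq : R ^ 2 / t ≤ t := by
      rw [div_le_iff₀ ht]
      nlinarith
    have hq0 : 0 ≤ R ^ 2 / t := by positivity
    have hq1 : R ^ 2 / t * t = R ^ 2 := by field_simp
    simp only [norm_eq_of_mem_sphere, mul_one, Real.norm_eq_abs, sq_abs]
    rw [hs, neg_div]
    nlinarith [sq_nonneg (supportFn K u)]
  have h3 := hc.smul_mem_of_zero_mem h0 hsmem (t := r / s)
    ⟨by have : 0 < s := hr.trans h
        positivity, (div_le_one (hr.trans h)).2 h.le⟩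
  rwa [smul_smul, div_mul_cancel₀ _ (hr.trans h).ne'] at h3

theorem continuous_supportFn_sphere (hK : IsCompact K) : Continuous fun u : S2 ↦ supportFn K u :=
  (continuous_supportFn hK).comp continuous_subtype_val

theorem integrable_of_continuous_sphere {f : S2 → ℝ} (hf : Continuous f) :
    Integrable f sphereMeasure :=
  hf.integrable_of_hasCompactSupport (HasCompactSupport.of_compactSpace _)

theorem quotient_integral_radius_cubed {g : S2 → ℝ} (hg : Continuous g) {t : ℝ} (ht : 0 < t) :
    (∫ u, (t + g u) ^ 3 / 3 ∂sphereMeasure - 4 / 3 * Real.pi * t ^ 3) / t ^ 2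
      = ∫ u, (g u + g u ^ 2 * t⁻¹ + g u ^ 3 / 3 * (t⁻¹ * t⁻¹)) ∂sphereMeasure := by
  have h0 : 4 / 3 * Real.pi * t ^ 3 = ∫ _ : S2, t ^ 3 / 3 ∂sphereMeasure := by
    rw [integral_const, sphereMeasure_real_univ, smul_eq_mul]
    ring
  rw [h0, ← integral_sub (integrable_of_continuous_sphere (by fun_prop))
    (integrable_of_continuous_sphere (by fun_prop)), ← integral_div]
  refine integral_congr_ae (.of_forall fun u ↦ ?_)
  field_simp
  ring

/-- After cancellation of t³, only the term linear in the perturbation survives division by t², so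
an O(1/t) error in the radius does not affect the limit. -/
theorem tendsto_quotient_integral_radius_cubed {h : S2 → ℝ} (hh : Continuous h) (c : ℝ) :
    Tendsto (fun t : ℝ ↦ (∫ u, (t + (h u + c / t)) ^ 3 / 3 ∂sphereMeasure
      - 4 / 3 * Real.pi * t ^ 3) / t ^ 2) atTop (𝓝 (∫ u, h u ∂sphereMeasure)) := by
  obtain ⟨C, hC⟩ : ∃ C, ∀ u, |h u| ≤ C := by
    obtain ⟨C, hC⟩ := isCompact_univ.exists_bound_of_continuousOn (f := h) hh.continuousOn
    exact ⟨C, fun u ↦ hC u (mem_univ u)⟩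
  have hlim : Tendsto (fun t : ℝ ↦ ∫ u, ((h u + c / t) + (h u + c / t) ^ 2 * t⁻¹
      + (h u + c / t) ^ 3 / 3 * (t⁻¹ * t⁻¹)) ∂sphereMeasure) atTop
      (𝓝 (∫ u, h u ∂sphereMeasure)) := by
    refine tendsto_integral_filter_of_dominated_convergence
      (fun _ ↦ (C + |c|) + (C + |c|) ^ 2 + (C + |c|) ^ 3 / 3) ?_ ?_ (integrable_const _) ?_
    · filter_upwards with t
      exact Continuous.aestronglyMeasurable (by fun_prop)
    · filter_upwards [eventually_ge_atTop 1] with t ht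
      refine .of_forall fun u ↦ ?_
      have ht0 : 0 < t := by linarith
      have hti : t⁻¹ ≤ 1 := inv_le_one_of_one_le₀ ht
      have hti0 : 0 ≤ t⁻¹ := by positivity
      have hs : |h u + c / t| ≤ C + |c| := by
        refine (abs_add_le _ _).trans (add_le_add (hC u) ?_)
        rw [abs_div, abs_of_pos ht0]
        exact div_le_self (abs_nonneg _) ht
      have hD : 0 ≤ C + |c| := (abs_nonneg _).trans hs
      refine (norm_add₃_le).trans (add_le_add (add_le_add hs ?_) ?_)
      · rw [Real.norm_eq_abs, abs_mul, abs_pow, abs_of_nonneg hti0]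
        exact (mul_le_of_le_one_right (by positivity) hti).trans
          (pow_le_pow_left₀ (abs_nonneg _) hs 2)
      · rw [Real.norm_eq_abs, abs_mul, abs_div, abs_pow, abs_of_nonneg (mul_nonneg hti0 hti0),
          abs_of_pos (show (0 : ℝ) < 3 by norm_num)]
        refine (mul_le_of_le_one_right (by positivity) (mul_le_one₀ hti hti0 hti)).trans ?_
        gcongr
    · refine .of_forall fun u ↦ ?_
      have h1 : Tendsto (fun t : ℝ ↦ t⁻¹) atTop (𝓝 0) := tendsto_inv_atTop_zero
      have h2 : Tendsto (fun t : ℝ ↦ h u + c / t) atTop (𝓝 (h u + c * 0)) := by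
        simp only [div_eq_mul_inv]
        exact (h1.const_mul c).const_add (h u)
      have h3 := (h2.add ((h2.pow 2).mul h1)).add (((h2.pow 3).div_const 3).mul (h1.mul h1))
      simpa using h3
  refine hlim.congr' ?_
  filter_upwards [eventually_gt_atTop 0] with t ht
  exact (quotient_integral_radius_cubed (by fun_prop) ht).symm

/-- The mean width form of the second-order Steiner coefficient. -/
theorem tendsto_steinerQuotient (hK : IsCompact K) (hconv : Convex ℝ K) (hne : K.Nonempty) :
    Tendsto (steinerQuotient K) atTop (𝓝 (∫ u : S2, supportFn K u ∂sphereMeasure)) := by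
  obtain ⟨R, hR⟩ := hK.isBounded.exists_norm_le
  have hh := continuous_supportFn_sphere hK
  have hR0 : 0 ≤ R := (norm_nonneg _).trans (hR _ hne.some_mem)
  have hb := abs_supportFn_le hK hne hR
  -- The constant -R² is the loss in the inner estimate; 1 merely makes the outer bound r ≤ t + h(u)
  -- strict.
  refine tendsto_of_tendsto_of_tendsto_of_le_of_le'
    (tendsto_quotient_integral_radius_cubed hh (-R ^ 2))
    (tendsto_quotient_integral_radius_cubed hh 1) ?_ ?_
  · filter_upwards [eventually_gt_atTop (2 * R + 1)] with t ht
    have ht0 : 0 < t := by linarith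
    have hS : volume (K + Metric.closedBall (0 : E3) t) ≠ ⊤ :=
      (hK.add (isCompact_closedBall _ _)).measure_lt_top.ne
    unfold steinerQuotient
    gcongr
    refine le_volume_real_of_radius hS (by fun_prop) (fun u ↦ ?_) fun u r hr hru ↦ ?_
    · have h1 : R ^ 2 / t ≤ R := by
        rw [div_le_iff₀ ht0]
        nlinarith
      have := (abs_le.1 (hb u)).1
      rw [neg_div]
      linarith
    · exact mem_add_closedBall_of_lt_radius hK hconv hne hR ht0 (by linarith) u hr
        (by rwa [add_assoc])
  · filter_upwards [eventually_gt_atTop R] with t ht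
    have ht0 : 0 < t := by linarith
    have ht1 : 0 < 1 / t := by positivity
    unfold steinerQuotient
    gcongr
    refine volume_real_le_of_radius (by fun_prop) (fun u ↦ ?_) fun u r hr hru ↦ ?_
    · have := (abs_le.1 (hb u)).1
      linarith
    · have := le_radius_of_mem_add_closedBall hK u hru
      linarith

theorem meanCurvatureIntegral_eq_integral_supportFn (hK : IsCompact K) (hconv : Convex ℝ K)
    (hne : K.Nonempty) :
    meanCurvatureIntegral K = ∫ u : S2, supportFn K u ∂sphereMeasure :=
  (tendsto_steinerQuotient hK hconv hne).limUnder_eq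

end SupportFunction

/-! ### Determinants of random unit triples -/

/-- The determinant of the matrix whose rows are three given unit vectors. -/
noncomputable def sphereDet (v : Fin 3 → S2) : ℝ :=
  Matrix.det (Matrix.of fun i j : Fin 3 => (v i : E3) j)

theorem continuous_sphereDet : Continuous sphereDet := by
  refine Continuous.matrix_det (continuous_matrix fun i j ↦ ?_)
  simp only [Matrix.of_apply]
  fun_prop

/-- The product measure on triples of unit vectors. -/
noncomputable abbrev sphereTripleMeasure : Measure (Fin 3 → S2) :=
  Measure.pi fun _ : Fin 3 => sphereMeasure

theorem measurePreserving_sphere_triple :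
    MeasurePreserving (fun p : S2 × S2 × S2 ↦ (![p.1, p.2.1, p.2.2] : Fin 3 → S2))
      (sphereMeasure.prod (sphereMeasure.prod sphereMeasure)) sphereTripleMeasure := by
  have h1 := (measurePreserving_piFinSuccAbove (fun _ : Fin 3 ↦ sphereMeasure) 0).symm
  have h2 := (measurePreserving_finTwoArrow sphereMeasure).symm
  have h3 := (MeasurePreserving.id sphereMeasure).prod h2
  convert! h1.comp h3 using 1
  ext p i : 2
  fin_cases i <;> rfl

theorem measurableEmbedding_sphere_triple :
    MeasurableEmbedding (fun p : S2 × S2 × S2 ↦ (![p.1, p.2.1, p.2.2] : Fin 3 → S2)) := by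
  refine (Continuous.isClosedEmbedding (by fun_prop) fun p q h ↦ ?_).measurableEmbedding
  have h0 := congr_fun h 0
  have h1 := congr_fun h 1
  have h2 := congr_fun h 2
  exact Prod.ext h0 (Prod.ext h1 h2)

/-- The cross product of vectors of Euclidean three-space. -/
noncomputable def euclideanCross (a b : E3) : E3 :=
  WithLp.toLp 2 (crossProduct (WithLp.ofLp a) (WithLp.ofLp b))

theorem sphereDet_eq_inner (a b c : S2) :
    sphereDet ![a, b, c] = inner ℝ (euclideanCross a b) (c : E3) := by
  simp [sphereDet, Matrix.det_fin_three, euclideanCross, cross_apply, PiLp.inner_apply,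
    Fin.sum_univ_three]
  ring

theorem norm_euclideanCross_sq (a b : E3) :
    ‖euclideanCross a b‖ ^ 2 = ‖a‖ ^ 2 * ‖b‖ ^ 2 - inner ℝ a b ^ 2 := by
  simp [euclideanCross, cross_apply, PiLp.inner_apply, EuclideanSpace.real_norm_sq_eq,
    Fin.sum_univ_three]
  ring

theorem norm_euclideanCross_sphere (a b : S2) :
    ‖euclideanCross a b‖ = √(1 - inner ℝ (a : E3) (b : E3) ^ 2) := by
  rw [← Real.sqrt_sq (norm_nonneg (euclideanCross a b)), norm_euclideanCross_sq]
  simp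

theorem integrable_abs_sphereDet : Integrable (fun v ↦ |sphereDet v|) sphereTripleMeasure :=
  Continuous.integrable_of_hasCompactSupport continuous_sphereDet.abs
    (HasCompactSupport.of_compactSpace _)

/-- Integrating out c in |⟨a × b, c⟩| gives 2π‖a × b‖, then b gives a factor π², and a gives 4π. -/
theorem integral_abs_sphereDet : ∫ v, |sphereDet v| ∂sphereTripleMeasure = 8 * Real.pi ^ 4 := by
  have hi := (measurePreserving_sphere_triple.integrable_comp_emb
    measurableEmbedding_sphere_triple).2 integrable_abs_sphereDet
  have hinner : ∀ a : S2, ∫ q : S2 × S2, |sphereDet ![a, q.1, q.2]|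
      ∂(sphereMeasure.prod sphereMeasure) = 2 * Real.pi * Real.pi ^ 2 := by
    intro a
    have hc : Continuous fun q : S2 × S2 ↦ |sphereDet ![a, q.1, q.2]| :=
      (continuous_sphereDet.comp (by fun_prop)).abs
    rw [integral_prod _ (hc.integrable_of_hasCompactSupport (HasCompactSupport.of_compactSpace _))]
    simp only [sphereDet_eq_inner, integral_sphere_abs_inner, norm_euclideanCross_sphere,
      integral_const_mul, integral_sphere_sqrt_one_sub_inner_sq]
  rw [← measurePreserving_sphere_triple.integral_comp measurableEmbedding_sphere_triple,
    integral_prod (fun p : S2 × S2 × S2 ↦ |sphereDet ![p.1, p.2.1, p.2.2]|) hi]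
  simp only [hinner, integral_const, sphereMeasure_real_univ, smul_eq_mul]
  ring

theorem sphereMeasure_submodule_eq_zero (W : Submodule ℝ E3) (hW : W ≠ ⊤) :
    sphereMeasure {u : S2 | (u : E3) ∈ W} = 0 := by
  have hm : MeasurableSet {u : S2 | (u : E3) ∈ W} :=
    (W.closed_of_finiteDimensional.preimage continuous_subtype_val).measurableSet
  rw [sphereMeasure, Measure.toSphere_apply' _ hm]
  refine mul_eq_zero_of_right _ (measure_mono_null ?_ (Measure.addHaar_submodule volume W hW))
  rintro _ ⟨r, -, _, ⟨u, hu, rfl⟩, rfl⟩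
  exact W.smul_mem r hu

theorem ae_inner_ne_zero {x : E3} (hx : x ≠ 0) :
    ∀ᵐ u : S2 ∂sphereMeasure, inner ℝ x (u : E3) ≠ 0 := by
  have h := sphereMeasure_submodule_eq_zero (Submodule.span ℝ {x})ᗮ (by
    intro h
    have hx' : x ∈ (Submodule.span ℝ {x})ᗮ := h ▸ Submodule.mem_top
    rw [Submodule.mem_orthogonal_singleton_iff_inner_right] at hx'
    exact hx (inner_self_eq_zero.1 hx'))
  rw [ae_iff]
  convert h using 2
  ext u
  simp [Submodule.mem_orthogonal_singleton_iff_inner_right]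

theorem ae_euclideanCross_ne_zero (a : S2) : ∀ᵐ b : S2 ∂sphereMeasure, euclideanCross a b ≠ 0 := by
  have h := sphereMeasure_submodule_eq_zero (Submodule.span ℝ {(a : E3)}) (by
    intro h
    have h1 := finrank_span_singleton (K := ℝ) (v := (a : E3)) (ne_zero_of_mem_unit_sphere a)
    rw [h, finrank_top] at h1
    simp at h1)
  rw [ae_iff]
  refine measure_mono_null (fun b hb ↦ ?_) h
  simp only [ne_eq, not_not, mem_ofPred_eq] at hb
  have h1 := norm_euclideanCross_sq a b
  rw [hb] at h1
  simp only [norm_zero, norm_eq_of_mem_sphere] at h1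
  -- A vanishing cross product forces ⟨a, b⟩² = 1, so b equals its projection onto the line of a.
  have h2 : ‖(b : E3) - inner ℝ (a : E3) (b : E3) • (a : E3)‖ ^ 2 = 0 := by
    rw [norm_sub_sq_real, real_inner_smul_right, norm_smul, real_inner_comm]
    simp only [norm_eq_of_mem_sphere, mul_one, Real.norm_eq_abs, sq_abs]
    rw [real_inner_comm]
    linarith
  rw [sq_eq_zero_iff, norm_eq_zero, sub_eq_zero] at h2
  exact Submodule.mem_span_singleton.2 ⟨_, h2.symm⟩

/-- By Fubini: almost every b is off the line of a, and then almost every c is off the plane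
orthogonal to a × b. -/
theorem ae_sphereDet_ne_zero : ∀ᵐ v ∂sphereTripleMeasure, sphereDet v ≠ 0 := by
  have hm : MeasurableSet {v | sphereDet v = 0} :=
    (isClosed_singleton.preimage continuous_sphereDet).measurableSet
  rw [ae_iff]
  simp only [ne_eq, not_not]
  have hm' := measurePreserving_sphere_triple.measurable hm
  rw [← measurePreserving_sphere_triple.measure_preimage hm.nullMeasurableSet,
    Measure.measure_prod_null hm']
  refine .of_forall fun a ↦ ?_
  refine (Measure.measure_prod_null (measurable_prodMk_left hm')).2 ?_
  filter_upwards [ae_euclideanCross_ne_zero a] with b hb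
  have h := ae_inner_ne_zero hb
  rw [ae_iff] at h
  convert! h using 2
  ext c
  simp [sphereDet_eq_inner]

/-! ### Triples of planes meeting K -/

section Planes
variable {K : Set E3}

/-- Pairs of a point and a triple of unit vectors such that the three planes through the point
orthogonal to the vectors lie between the supporting planes of `K`. -/
def planesMeeting (K : Set E3) : Set (E3 × (Fin 3 → S2)) :=
  {q | ∀ i, inner ℝ (q.2 i : E3) q.1 ∈ Icc (-supportFn K (-(q.2 i : E3))) (supportFn K (q.2 i))}

theorem isClosed_planesMeeting (hK : IsCompact K) : IsClosed (planesMeeting K) := by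
  have hc := continuous_supportFn hK
  simp only [planesMeeting, mem_Icc, ofPred_forall, ofPred_and]
  refine isClosed_iInter fun i ↦ IsClosed.inter (isClosed_le ?_ ?_) (isClosed_le ?_ ?_) <;> fun_prop

theorem mem_planesMeeting_iff (hK : IsCompact K) (hconv : Convex ℝ K) (hne : K.Nonempty)
    (P : E3) (v : Fin 3 → S2) :
    (P, v) ∈ planesMeeting K ↔ ∀ i, ∃ Q ∈ K, inner ℝ (v i : E3) (Q - P) = 0 := by
  refine forall_congr' fun i ↦ ?_
  simp only [← image_inner_eq_Icc hK hconv hne, mem_image, inner_sub_right, sub_eq_zero]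

/-- As P ∉ K, the vector Q - P is nonzero and can be normalised to a direction in the solid angle.
-/
theorem mem_greatCirclesMeeting_solidAngle_iff {P : E3} (hP : P ∉ K) (v : S2) :
    v ∈ greatCirclesMeeting (solidAngle K P) ↔ ∃ Q ∈ K, inner ℝ (v : E3) (Q - P) = 0 := by
  constructor
  · rintro ⟨u, ⟨t, -, ht⟩, hu⟩
    exact ⟨_, ht, by rw [add_sub_cancel_left, real_inner_smul_right, hu, mul_zero]⟩
  · rintro ⟨Q, hQ, h⟩
    have hne : Q - P ≠ 0 := fun h0 ↦ hP (sub_eq_zero.1 h0 ▸ hQ)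
    refine ⟨⟨‖Q - P‖⁻¹ • (Q - P), by simpa using norm_smul_inv_norm (𝕜 := ℝ) hne⟩,
      ⟨‖Q - P‖, norm_nonneg _, ?_⟩, ?_⟩
    · rw [smul_smul, mul_inv_cancel₀ (norm_ne_zero_iff.2 hne), one_smul, add_sub_cancel]
      exact hQ
    · rw [real_inner_smul_right, h, mul_zero]

/-- The integral of `|det|` over the triples of planes through `P` that meet `K`. -/
noncomputable def planeTripleIntegral (K : Set E3) (P : E3) : ENNReal :=
  ∫⁻ v, (planesMeeting K).indicator (fun q ↦ ENNReal.ofReal |sphereDet q.2|) (P, v)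
    ∂sphereTripleMeasure

theorem measurable_indicator_planesMeeting (hK : IsCompact K) :
    Measurable ((planesMeeting K).indicator fun q ↦ ENNReal.ofReal |sphereDet q.2|) :=
  Measurable.indicator
    (ENNReal.continuous_ofReal.comp (continuous_sphereDet.comp continuous_snd).abs).measurable
    (isClosed_planesMeeting hK).measurableSet

theorem measurable_planeTripleIntegral (hK : IsCompact K) : Measurable (planeTripleIntegral K) :=
  (measurable_indicator_planesMeeting hK).lintegral_prod_right'

theorem solidAngleBeta_eq (hK : IsCompact K) (hconv : Convex ℝ K) (hne : K.Nonempty) {P : E3}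
    (hP : P ∉ K) :
    solidAngleBeta (solidAngle K P) = 1 / 8 * (planeTripleIntegral K P).toReal := by
  have hs : univ.pi (fun _ : Fin 3 ↦ greatCirclesMeeting (solidAngle K P))
      = Prod.mk P ⁻¹' planesMeeting K := by
    ext v
    rw [mem_preimage, mem_planesMeeting_iff hK hconv hne]
    simp only [mem_univ_pi, mem_greatCirclesMeeting_solidAngle_iff hP]
  have hm : MeasurableSet (Prod.mk P ⁻¹' planesMeeting K) :=
    measurable_prodMk_left (isClosed_planesMeeting hK).measurableSet
  change 1 / 8 * ∫ v in univ.pi (fun _ : Fin 3 ↦ greatCirclesMeeting (solidAngle K P)),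
    |sphereDet v| ∂sphereTripleMeasure = _
  rw [hs, integral_eq_lintegral_of_nonneg_ae (.of_forall fun v ↦ abs_nonneg _)
    continuous_sphereDet.abs.aestronglyMeasurable, ← lintegral_indicator hm]
  rfl

theorem planeTripleIntegral_of_mem (hK : IsCompact K) (hconv : Convex ℝ K) {P : E3} (hP : P ∈ K) :
    planeTripleIntegral K P = ENNReal.ofReal (8 * Real.pi ^ 4) := by
  rw [← integral_abs_sphereDet, ofReal_integral_eq_lintegral_ofReal integrable_abs_sphereDet
    (.of_forall fun v ↦ abs_nonneg _)]
  refine lintegral_congr fun v ↦ indicator_of_mem ?_ _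
  rw [mem_planesMeeting_iff hK hconv ⟨P, hP⟩]
  exact fun i ↦ ⟨P, hP, by simp⟩

theorem width_nonneg (hK : IsCompact K) (hne : K.Nonempty) (x : E3) :
    0 ≤ supportFn K x + supportFn K (-x) := by
  obtain ⟨y, hy⟩ := hne
  have h1 := inner_le_supportFn hK x hy
  have h2 := inner_le_supportFn hK (-x) hy
  rw [inner_neg_left] at h2
  linarith

theorem integral_width (hK : IsCompact K) (hne : K.Nonempty) :
    ∫ u : S2, (supportFn K u + supportFn K (-(u : E3))) ∂sphereMeasure
      = 2 * ∫ u : S2, supportFn K u ∂sphereMeasure := by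
  have hc := continuous_supportFn hK
  rw [integral_add (integrable_of_continuous_sphere (by fun_prop))
    (integrable_of_continuous_sphere (by fun_prop)), integral_sphere_neg (supportFn_smul hK hne)]
  ring

/-- The admissible P form the preimage of a box under the linear map with rows vᵢ, so their volume
is the product of the widths divided by |det|. -/
theorem volume_points_mul_sphereDet (hK : IsCompact K) (hne : K.Nonempty)
    {v : Fin 3 → S2} (hv : sphereDet v ≠ 0) :
    ENNReal.ofReal |sphereDet v| * volume ((fun P ↦ (P, v)) ⁻¹' planesMeeting K)
      = ENNReal.ofReal (∏ i, (supportFn K (v i) + supportFn K (-(v i : E3)))) := by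
  set A : Matrix (Fin 3) (Fin 3) ℝ := Matrix.of fun i j ↦ (v i : E3) j with hA
  have hdet : LinearMap.det (Matrix.toLin' A) = sphereDet v := LinearMap.det_toLin' A
  set B : Set (Fin 3 → ℝ) := Icc (fun i ↦ -supportFn K (-(v i : E3))) (fun i ↦ supportFn K (v i))
    with hB
  have hset : (fun P ↦ (P, v)) ⁻¹' planesMeeting K
      = (MeasurableEquiv.toLp 2 (Fin 3 → ℝ)).symm ⁻¹' (Matrix.toLin' A ⁻¹' B) := by
    ext P
    have hi : ∀ i, Matrix.toLin' A (WithLp.ofLp P) i = inner ℝ (v i : E3) P := fun i ↦ by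
      simp [hA, Matrix.mulVec, dotProduct, PiLp.inner_apply, Fin.sum_univ_three, mul_comm]
    simp only [mem_preimage, planesMeeting, mem_ofPred_eq, hB, mem_Icc, Pi.le_def]
    rw [← forall_and]
    exact forall_congr' fun i ↦ by rw [← hi]; rfl
  have hw : ∀ i, 0 ≤ supportFn K (v i) + supportFn K (-(v i : E3)) := fun i ↦
    width_nonneg hK hne (v i)
  rw [hset, (EuclideanSpace.volume_preserving_symm_measurableEquiv_toLp
    (Fin 3)).measure_preimage_equiv, Measure.addHaar_preimage_linearMap volume (hdet ▸ hv), hdet,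
    ← mul_assoc, ← ENNReal.ofReal_mul (abs_nonneg _), ← abs_mul, mul_inv_cancel₀ hv, hB,
    Real.volume_Icc_pi, ENNReal.ofReal_prod_of_nonneg fun i _ ↦ hw i]
  simp

theorem lintegral_planeTripleIntegral (hK : IsCompact K) (hne : K.Nonempty) :
    ∫⁻ P, planeTripleIntegral K P
      = ENNReal.ofReal (8 * (∫ u : S2, supportFn K u ∂sphereMeasure) ^ 3) := by
  have hc := continuous_supportFn hK
  have hw := integral_width hK hne
  have hprod : ∫ v : Fin 3 → S2, ∏ i, (supportFn K (v i) + supportFn K (-(v i : E3)))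
      ∂sphereTripleMeasure = 8 * (∫ u : S2, supportFn K u ∂sphereMeasure) ^ 3 := by
    rw [integral_fintype_prod_eq_prod (μ := fun _ : Fin 3 ↦ sphereMeasure)
      (fun (_ : Fin 3) (u : S2) ↦ supportFn K u + supportFn K (-(u : E3)))]
    simp only [hw, Finset.prod_const, Finset.card_univ, Fintype.card_fin]
    ring
  have hnn : ∀ v : Fin 3 → S2, 0 ≤ ∏ i, (supportFn K (v i) + supportFn K (-(v i : E3))) :=
    fun v ↦ Finset.prod_nonneg fun i _ ↦ width_nonneg hK hne (v i)
  rw [← hprod, ofReal_integral_eq_lintegral_ofReal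
    (Continuous.integrable_of_hasCompactSupport (by fun_prop) (HasCompactSupport.of_compactSpace _))
    (.of_forall hnn)]
  unfold planeTripleIntegral
  rw [lintegral_lintegral_swap
    (f := fun P v ↦ (planesMeeting K).indicator (fun q ↦ ENNReal.ofReal |sphereDet q.2|) (P, v))
    (measurable_indicator_planesMeeting hK).aemeasurable]
  refine lintegral_congr_ae ?_
  filter_upwards [ae_sphereDet_ne_zero] with v hv
  rw [← volume_points_mul_sphereDet hK hne hv, ← setLIntegral_const,
    ← lintegral_indicator (measurable_prodMk_right (isClosed_planesMeeting hK).measurableSet)]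
  rfl

end Planes

/-! ### Splitting the total integral over K and its complement -/

theorem theorem1p2 (K : Set E3) (hK : IsCompact K) (hconv : Convex ℝ K) (hne : K.Nonempty) :
    Filter.Tendsto (steinerQuotient K) Filter.atTop (nhds (meanCurvatureIntegral K)) ∧
    MeasureTheory.IntegrableOn (fun P : E3 => solidAngleBeta (solidAngle K P)) Kᶜ
      MeasureTheory.volume ∧
    meanCurvatureIntegral K ^ 3 - Real.pi ^ 4 * MeasureTheory.volume.real K
      = ∫ P in Kᶜ, solidAngleBeta (solidAngle K P) := by
  have hM := meanCurvatureIntegral_eq_integral_supportFn hK hconv hne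
  have hKm := hK.measurableSet
  have htotal := lintegral_planeTripleIntegral hK hne
  rw [← hM] at htotal
  have hJ := measurable_planeTripleIntegral hK
  have hsplit := lintegral_add_compl (planeTripleIntegral K) hKm (μ := volume)
  have hinside : ∫⁻ P in K, planeTripleIntegral K P
      = ENNReal.ofReal (8 * Real.pi ^ 4) * volume K := by
    rw [setLIntegral_congr_fun hKm fun P hP ↦ planeTripleIntegral_of_mem hK hconv hP,
      setLIntegral_const]
  have hfin : ∫⁻ P in Kᶜ, planeTripleIntegral K P ≠ ⊤ := by
    refine ne_top_of_le_ne_top ?_ (setLIntegral_le_lintegral Kᶜ _)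
    rw [htotal]
    exact ENNReal.ofReal_ne_top
  have hcongr : EqOn (fun P ↦ solidAngleBeta (solidAngle K P))
      (fun P ↦ 1 / 8 * (planeTripleIntegral K P).toReal) Kᶜ :=
    fun P hP ↦ solidAngleBeta_eq hK hconv hne hP
  refine ⟨hM ▸ tendsto_steinerQuotient hK hconv hne, ?_, ?_⟩
  · rw [integrableOn_congr_fun hcongr hKm.compl]
    exact (integrable_toReal_of_lintegral_ne_top hJ.aemeasurable hfin).const_mul _
  · rw [setIntegral_congr_fun hKm.compl hcongr, integral_const_mul,
      integral_toReal hJ.aemeasurable (ae_lt_top hJ hfin)]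
    -- `ENNReal.ofReal` truncates negative values, so M ≥ 0 is needed; it holds because 2M is the
    -- integral of the nonnegative width.
    have hM0 : 0 ≤ 8 * meanCurvatureIntegral K ^ 3 := by
      have h1 := integral_width hK hne
      have h2 : 0 ≤ ∫ u : S2, (supportFn K u + supportFn K (-(u : E3))) ∂sphereMeasure :=
        integral_nonneg fun u ↦ width_nonneg hK hne u
      have h3 : 0 ≤ meanCurvatureIntegral K := by linarith
      positivity
    have h := congr_arg ENNReal.toReal (hsplit.trans htotal)
    rw [hinside, ENNReal.toReal_add
      (ENNReal.mul_ne_top ENNReal.ofReal_ne_top hK.measure_lt_top.ne) hfin, ENNReal.toReal_mul,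
      ENNReal.toReal_ofReal (by positivity), ENNReal.toReal_ofReal hM0] at h
    rw [measureReal_def]
    linarith
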